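/- Let $\mathbb{D}=\{z\in\mathbb{C}:|z|<1\}$. For functions $f,g$ on $\mathbb{D}$ write $f\prec g$ ($f$ is subordinate to $g$) if there is an analytic $w:\mathbb{D}\to\mathbb{D}$ with $w(0)=0$ and $f(z)=g(w(z))$ for all $z\in\mathbb{D}$. Let $\varphi_{Ne}(z)=1+z-z^3/3$, and let $A,B$ be real numbers with $-1<B<A\le 1$ and $B\neq 0$. For $j\in\{0,1,2\}$ put $M_j=\max\{\beta_1^{(j)},\beta_2^{(j)}\}$, where $$\beta_1^{(0)}=\frac{A-B}{2B}\log\left((1-B)^{-3}\right),\qquad \beta_2^{(0)}=\frac{A-B}{2B}\log\left((1+B)^{3}\right),$$ $$\beta_1^{(1)}=\frac{A-B}{B\log 3}\log\left((1-B)^{-1}\right),\qquad \beta_2^{(1)}=\frac{A-B}{B\log(5/3)}\log(1+B),$$ $$\beta_1^{(2)}=\frac{A-B}{2B}\log\left((1-B)^{-1}\right),\qquad \beta_2^{(2)}=\frac{A-B}{2B}\log\left((1+B)^{5}\right).$$ Then for each $j\in\{0,1,2\}$ and every real $\beta\ge M_j$: if $p$ is analytic in $\mathbb{D}$ with $p(0)=1$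 and $$1+\beta\,\frac{z\,p'(z)}{p(z)^j}\prec\frac{1+Az}{1+Bz},$$ then $p\prec\varphi_{Ne}$. Moreover, each estimate $\beta\ge M_j$ is best possible: $M_j$ is the least real number $b$ such that this implication holds (for all such $p$) for every $\beta\ge b$; indeed, for every $\beta$ with $0<\beta<M_j$ there is an analytic $p$ in $\mathbb{D}$ with $p(0)=1$ (and without zeros in $\mathbb{D}$ if $j\neq 0$) which satisfies the differential subordination but for which $p\not\prec\varphi_{Ne}$. -/

import Mathlib

open Complex Metric

/-- `Subordinate f g`: on the open unit disk `f = g ∘ w` for some Schwarz function `w`, that is,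
`w` is holomorphic on the disk, `w 0 = 0` and `|w z| < 1`. -/
def Subordinate (f g : ℂ → ℂ) : Prop :=
  ∃ w : ℂ → ℂ, DifferentiableOn ℂ w (ball 0 1) ∧ w 0 = 0 ∧
    (∀ z ∈ ball (0 : ℂ) 1, ‖w z‖ < 1) ∧ ∀ z ∈ ball (0 : ℂ) 1, f z = g (w z)

/-- The nephroid function `1 + z - z ^ 3 / 3`. -/
noncomputable def nephroid (z : ℂ) : ℂ := 1 + z - z ^ 3 / 3

/-- The Janowski function `(1 + A z) / (1 + B z)`. -/
noncomputable def janowski (A B : ℝ) (z : ℂ) : ℂ := (1 + A * z) / (1 + B * z)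

/-- The expression `1 + β z p'(z) / p(z) ^ j`. -/
noncomputable def diffExpr (β : ℝ) (j : ℕ) (p : ℂ → ℂ) (z : ℂ) : ℂ :=
  1 + β * (z * deriv p z / p z ^ j)

/-- Holomorphic functions on the open unit disk with value `1` at the origin. -/
def IsNormalized (p : ℂ → ℂ) : Prop := DifferentiableOn ℂ p (ball 0 1) ∧ p 0 = 1

/-- `M` is a valid lower bound for `β`: for every real `β ≥ M`, the differential subordination
with exponent `j` and the Janowski function implies subordination to the nephroid function. -/
def SufficientBound (A B : ℝ) (j : ℕ) (M : ℝ) : Prop :=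
  ∀ β : ℝ, M ≤ β → ∀ p : ℂ → ℂ, IsNormalized p →
    Subordinate (diffExpr β j p) (janowski A B) → Subordinate p nephroid

/-- The implication fails for every positive `β` below `M`. If `j ≠ 0` the witness `p` has no
zeros in the disk, so that `z p' / p ^ j` is a genuine quotient. -/
def FailsBelow (A B : ℝ) (j : ℕ) (M : ℝ) : Prop :=
  ∀ β : ℝ, 0 < β → β < M → ∃ p : ℂ → ℂ, IsNormalized p ∧
    (j ≠ 0 → ∀ z ∈ ball (0 : ℂ) 1, p z ≠ 0) ∧
    Subordinate (diffExpr β j p) (janowski A B) ∧ ¬ Subordinate p nephroid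

/-- `M` is the best possible lower bound: it is valid, no smaller number is a valid lower bound,
and in fact the implication fails for each individual positive `β < M`. -/
def BestPossibleBound (A B : ℝ) (j : ℕ) (M : ℝ) : Prop :=
  IsLeast {b : ℝ | SufficientBound A B j b} M ∧ FailsBelow A B j M

/-!
Fix `β > 0` and put `a = (A - B) / (β * B)`. The differential subordination says
`z * p' / p ^ j = a * B * w / (1 + B * w)` for a Schwarz function `w`. In terms of a function `P`
with `P' = p' / p ^ j` and `P 0 = 0`, that is, `p = 1 + P`, `p = exp P` or `p = 1 / (1 - P)` for
`j = 0, 1, 2`, it becomes `z * P' = a * B * w / (1 + B * w)`. For `w z = z` the solution is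
`P z = a * log (1 + B * z)`. It is increasing on `(-1, 1)`, and the endpoint values of `p` (for
`j = 2`, provided `p` has no pole) lie in the interval `[1 / 3, 5 / 3]`, which the closed nephroid
domain cuts out of the real axis, exactly when `β ≥ M_j`.

*Sufficiency.* By Jack's lemma (`norm_lt_one_of_forall_mul_deriv_ne`) every solution is
subordinate to this one: its values are `a * log (1 + x)` with `|x| < |B|`
(`exists_eq_log_of_mul_deriv_eq`). The corresponding values of `p` lie in the disk with diameter
`[1 / 3, 5 / 3]` as soon as the two real extreme values do. For `j = 0` and `j = 2` this
follows from the fact that `log` maps the disk `|s - 1| ≤ b` into the disk having the image of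
`[1 - b, 1 + b]` as a diameter (`norm_log_one_add_sub_le`, a comparison of hyperbolic and
logarithmic length). For `j = 1` it follows from the fact that `|s ^ a - 1|` is largest on
`|s - 1| ≤ b` at a real point (`norm_exp_mul_log_one_add_sub_one_le`). The nephroid is univalent on
the unit disk and its image contains the open disk of radius `2 / 3` about `1`, so `p ≺ nephroid`
(`subordinate_nephroid_of_norm_sub_one_le`).

For `j ≠ 0` the hypothesis forces `p` to be free of zeros, because at a zero `z * p' / p ^ j` would
have a pole (`IsNormalized.ne_zero_of_mul_deriv_div_pow_eq`).

*Sharpness.* If an endpoint value lies outside `[1 / 3, 5 / 3]`, the solution with `w z = z` has a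
real value outside the nephroid domain (`Subordinate.real_value_bounds`). For `j = 2` and small `β`
that solution may have a pole in the disk, and `w z = r * z` with a suitable `0 < r ≤ 1` is used
instead (`endpointNecessary_two`).
-/

open Filter Topology Set

/-! ### Subordination to the nephroid function -/

theorem nephroid_injOn_ball : InjOn nephroid (ball 0 1) := by
  intro u hu v hv h
  rw [mem_ball_zero_iff] at hu hv
  have hfac : (u - v) * (3 - (u ^ 2 + u * v + v ^ 2)) = 0 := by
    unfold nephroid at h
    linear_combination 3 * h
  rcases mul_eq_zero.mp hfac with h0 | h0
  · exact sub_eq_zero.mp h0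
  · exfalso
    have h3 : ‖(3 : ℂ)‖ = ‖u ^ 2 + u * v + v ^ 2‖ := by rw [sub_eq_zero.mp h0]
    have h4 : ‖u ^ 2 + u * v + v ^ 2‖ ≤ ‖u‖ ^ 2 + ‖u‖ * ‖v‖ + ‖v‖ ^ 2 := by
      refine (norm_add₃_le ..).trans ?_
      simp
    rw [show ‖(3 : ℂ)‖ = 3 by simp] at h3
    nlinarith [norm_nonneg u, norm_nonneg v]

theorem differentiable_nephroid : Differentiable ℂ nephroid := by
  unfold nephroid; fun_prop

theorem hasStrictDerivAt_nephroid (z : ℂ) : HasStrictDerivAt nephroid (1 - z ^ 2) z := by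
  have := ((hasStrictDerivAt_id z).const_add 1).sub (((hasStrictDerivAt_id z).pow 3).div_const 3)
  convert! this using 1
  simp

theorem isOpen_nephroid_image {s : Set ℂ} (hs : IsOpen s) : IsOpen (nephroid '' s) := by
  have han : AnalyticOnNhd ℂ nephroid univ :=
    differentiable_nephroid.differentiableOn.analyticOnNhd isOpen_univ
  rcases han.is_constant_or_isOpen isPreconnected_univ with ⟨w, hw⟩ | h
  · have h0 := hw 0 trivial
    have h1 := hw 1 trivial
    rw [← h1] at h0
    norm_num [nephroid] at h0
  · exact h s (subset_univ s) hs

/-- The image of the unit disk is open, and it is relatively closed in `ball 1 (2 / 3)` because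
`‖z - z ^ 3 / 3‖ ≥ 2 / 3` on the unit circle; so it contains that (connected) disk. -/
theorem ball_subset_nephroid_image : ball (1 : ℂ) (2 / 3) ⊆ nephroid '' ball 0 1 := by
  have hconn : IsPreconnected (ball (1 : ℂ) (2 / 3)) := (convex_ball _ _).isPreconnected
  have hclosed : IsClosed (nephroid '' closedBall 0 1) :=
    ((isCompact_closedBall 0 1).image differentiable_nephroid.continuous).isClosed
  refine hconn.subset_left_of_subset_union (isOpen_nephroid_image isOpen_ball)
    hclosed.isOpen_compl ?_ ?_ ?_
  · rw [disjoint_compl_right_iff_subset]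
    exact image_mono ball_subset_closedBall
  · intro v hv
    by_cases hvc : v ∈ nephroid '' closedBall 0 1
    · left
      obtain ⟨z, hz, rfl⟩ := hvc
      refine ⟨z, ?_, rfl⟩
      rw [mem_closedBall_zero_iff] at hz
      rw [mem_ball_zero_iff]
      refine lt_of_le_of_ne hz fun h1 => ?_
      rw [mem_ball, dist_eq_norm] at hv
      have : nephroid z - 1 = z * (1 - z ^ 2 / 3) := by unfold nephroid; ring
      rw [this, norm_mul, h1, one_mul] at hv
      have h2 := norm_sub_norm_le (1 : ℂ) (z ^ 2 / 3)
      norm_num [h1] at h2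
      linarith
    · exact Or.inr hvc
  · exact ⟨1, by simp, 0, by simp, by simp [nephroid]⟩

/-- Subordination to the univalent function `nephroid` only requires an inclusion of the images:
the Schwarz function is the inverse of `nephroid` composed with `p`. -/
theorem subordinate_nephroid_of_mapsTo {p : ℂ → ℂ} (hp : DifferentiableOn ℂ p (ball 0 1))
    (hp0 : p 0 = 1) (hmaps : MapsTo p (ball 0 1) (nephroid '' ball 0 1)) :
    Subordinate p nephroid := by
  have hex : ∀ v, v ∈ nephroid '' ball 0 1 → ∃ u ∈ ball (0 : ℂ) 1, nephroid u = v :=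
    fun v hv => hv
  choose! g hgball hg using hex
  have hgd : ∀ v ∈ nephroid '' ball 0 1, DifferentiableAt ℂ g v := by
    intro v hv
    have hopen := isOpen_nephroid_image (isOpen_ball (x := (0 : ℂ)) (ε := 1))
    have hcont : ContinuousAt g v := by
      rw [ContinuousAt, (nhds_basis_opens (g v)).tendsto_right_iff]
      rintro U ⟨hgU, hU⟩
      have hmem : nephroid '' (U ∩ ball 0 1) ∈ 𝓝 v :=
        (isOpen_nephroid_image (hU.inter isOpen_ball)).mem_nhds
          ⟨g v, ⟨hgU, hgball v hv⟩, hg v hv⟩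
      filter_upwards [hmem] with y hy
      obtain ⟨u, ⟨huU, hub⟩, rfl⟩ := hy
      have hyim : nephroid u ∈ nephroid '' ball 0 1 := ⟨u, hub, rfl⟩
      rwa [nephroid_injOn_ball (hgball _ hyim) hub (hg _ hyim)]
    have hne : 1 - g v ^ 2 ≠ 0 := by
      intro h
      have h1 := hgball v hv
      rw [mem_ball_zero_iff] at h1
      have h2 : ‖g v‖ ^ 2 = 1 := by rw [← norm_pow, ← sub_eq_zero.mp h, norm_one]
      nlinarith [norm_nonneg (g v)]
    exact ((hasStrictDerivAt_nephroid (g v)).hasDerivAt.of_local_left_inverse hcont hne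
      (by filter_upwards [hopen.mem_nhds hv] with y hy using hg y hy)).differentiableAt
  refine ⟨g ∘ p, fun z hz => ?_, ?_, fun z hz => ?_, fun z hz => (hg _ (hmaps hz)).symm⟩
  · exact (hgd _ (hmaps hz)).comp_differentiableWithinAt z (hp z hz)
  · have h1 : (1 : ℂ) ∈ nephroid '' ball 0 1 := ⟨0, by simp, by simp [nephroid]⟩
    rw [Function.comp_apply, hp0]
    exact nephroid_injOn_ball (hgball 1 h1) (by simp) (by rw [hg 1 h1]; simp [nephroid])
  · exact mem_ball_zero_iff.mp (hgball _ (hmaps hz))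

theorem subordinate_nephroid_of_norm_sub_one_le {p : ℂ → ℂ} (hp : IsNormalized p)
    (hle : ∀ z ∈ ball (0 : ℂ) 1, ‖p z - 1‖ ≤ 2 / 3) : Subordinate p nephroid := by
  refine subordinate_nephroid_of_mapsTo hp.1 hp.2 fun z hz => ball_subset_nephroid_image ?_
  have h := dist_le_div_mul_dist_of_mapsTo_ball hp.1 (R₂ := 2 / 3)
    (fun z hz => by rw [hp.2, mem_closedBall, dist_eq_norm]; exact hle z hz) hz
  rw [hp.2, dist_zero_right] at h
  rw [mem_ball_zero_iff] at hz
  rw [mem_ball]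
  linarith

/-- The nephroid domain meets the real axis in the interval `(1 / 3, 5 / 3)`: by injectivity and
symmetry, real values are taken at real points only. -/
theorem Subordinate.real_value_bounds {p : ℂ → ℂ} (h : Subordinate p nephroid) {z : ℂ}
    (hz : z ∈ ball (0 : ℂ) 1) {y : ℝ} (hy : p z = y) : 1 / 3 < y ∧ y < 5 / 3 := by
  obtain ⟨w, -, -, hw1, hw⟩ := h
  have hwz := hw1 z hz
  have heq : nephroid (w z) = y := by rw [← hw z hz, hy]
  have hconj : (starRingEnd ℂ) (w z) = w z := by
    refine nephroid_injOn_ball (by simpa using hwz) (by simpa using hwz) ?_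
    have := congrArg (starRingEnd ℂ) heq
    rw [conj_ofReal, ← heq] at this
    rw [← this]
    simp [nephroid, map_ofNat (starRingEnd ℂ) 3]
  obtain ⟨x, hx⟩ := conj_eq_iff_real.mp hconj
  rw [hx] at heq hwz
  rw [norm_real, Real.norm_eq_abs, abs_lt] at hwz
  have hxy : 1 + x - x ^ 3 / 3 = y := by
    unfold nephroid at heq
    exact_mod_cast heq
  obtain ⟨h1, h2⟩ := hwz
  have h3 : 0 < (1 + x) ^ 2 * (2 - x) := mul_pos (pow_pos (by linarith) 2) (by linarith)
  have h4 : 0 < (1 - x) ^ 2 * (2 + x) := mul_pos (pow_pos (by linarith) 2) (by linarith)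
  constructor
  · linarith
  · linarith

/-! ### Jack's lemma and the logarithmic dominant -/

/-- The boundary case of the Schwarz lemma (Jack's lemma), in the form of a principle of
contradiction: if `‖ω‖` reached the value `1` inside the disk, then at a point `z` of smallest
modulus with `‖ω z‖ = 1` one would have `z * ω' z = k * ω z` with a real `k ≥ 1`. -/
theorem norm_lt_one_of_forall_mul_deriv_ne {ω : ℂ → ℂ} (hω : DifferentiableOn ℂ ω (ball 0 1))
    (h0 : ω 0 = 0)
    (hne : ∀ z ∈ ball (0 : ℂ) 1, ‖ω z‖ = 1 → ∀ k : ℝ, 1 ≤ k → z * deriv ω z ≠ k * ω z) :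
    ∀ z ∈ ball (0 : ℂ) 1, ‖ω z‖ < 1 := by
  intro z₁ hz₁
  by_contra! hz₁ω
  rw [mem_ball_zero_iff] at hz₁
  have hsub : closedBall (0 : ℂ) ‖z₁‖ ⊆ ball 0 1 := closedBall_subset_ball hz₁
  -- A point of smallest modulus with `1 ≤ ‖ω z‖`.
  obtain ⟨z₀, hz₀, hmin⟩ : ∃ z₀ ∈ closedBall (0 : ℂ) ‖z₁‖ ∩ {z | 1 ≤ ‖ω z‖},
      ∀ z ∈ closedBall (0 : ℂ) ‖z₁‖ ∩ {z | 1 ≤ ‖ω z‖}, ‖z₀‖ ≤ ‖z‖ := by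
    have hcl : IsClosed (closedBall (0 : ℂ) ‖z₁‖ ∩ (fun z => ‖ω z‖) ⁻¹' Ici 1) :=
      ((hω.continuousOn.mono hsub).norm).preimage_isClosed_of_isClosed isClosed_closedBall
        isClosed_Ici
    have hcomp := (isCompact_closedBall (0 : ℂ) ‖z₁‖).of_isClosed_subset hcl inter_subset_left
    obtain ⟨z₀, h1, h2⟩ := hcomp.exists_isMinOn ⟨z₁, by simp, hz₁ω⟩ continuous_norm.continuousOn
    exact ⟨z₀, h1, fun z hz => h2 hz⟩
  have hz₀1 : z₀ ∈ ball (0 : ℂ) 1 := hsub hz₀.1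
  have hz₀ω : 1 ≤ ‖ω z₀‖ := hz₀.2
  have hz₀ne : z₀ ≠ 0 := by
    rintro rfl
    rw [h0, norm_zero] at hz₀ω
    linarith
  have hpos : 0 < ‖z₀‖ := norm_pos_iff.mpr hz₀ne
  have hlt : ∀ z ∈ ball (0 : ℂ) ‖z₀‖, ‖ω z‖ < 1 := by
    intro z hz
    rw [mem_ball_zero_iff] at hz
    by_contra! h
    have hz₀' := hz₀.1
    rw [mem_closedBall_zero_iff] at hz₀'
    have := hmin z ⟨by rw [mem_closedBall_zero_iff]; linarith, h⟩
    linarith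
  have hdiff : DifferentiableAt ℂ ω z₀ := hω.differentiableAt (isOpen_ball.mem_nhds hz₀1)
  have hz₀eq : ‖ω z₀‖ = 1 := by
    refine le_antisymm ?_ hz₀ω
    have hz₀cl : z₀ ∈ closure (ball (0 : ℂ) ‖z₀‖) := by
      rw [closure_ball _ hpos.ne']; simp
    exact hdiff.continuousAt.norm.continuousWithinAt.closure_le hz₀cl
      continuousWithinAt_const fun z hz => (hlt z hz).le
  have hschwarz : ∀ ζ : ℂ, ‖ζ‖ ≤ 1 → ‖ω (z₀ * ζ)‖ ≤ ‖ζ‖ := by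
    intro ζ hζ
    rcases hζ.lt_or_eq with h | h
    · have := dist_le_div_mul_dist_of_mapsTo_ball (f := ω) (c := 0) (R₁ := ‖z₀‖) (R₂ := 1)
        (z := z₀ * ζ) (hω.mono (ball_subset_ball (mem_ball_zero_iff.mp hz₀1).le))
        (fun z hz => by rw [h0, mem_closedBall_zero_iff]; exact (hlt z hz).le)
        (by rw [mem_ball_zero_iff, norm_mul]; exact mul_lt_of_lt_one_right hpos h)
      rw [h0, dist_zero_right, dist_zero_right, norm_mul] at this
      calc _ ≤ _ := this
        _ = ‖ζ‖ := by field_simp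
    · rw [h]
      by_contra! hc
      have hn : ‖z₀ * ζ‖ = ‖z₀‖ := by rw [norm_mul, h, mul_one]
      have hmem : z₀ * ζ ∈ closure (ball (0 : ℂ) ‖z₀‖) := by
        rw [closure_ball _ hpos.ne']; simp [h]
      have hd2 : DifferentiableAt ℂ ω (z₀ * ζ) := hω.differentiableAt
        (isOpen_ball.mem_nhds (by rw [mem_ball_zero_iff, hn]; exact mem_ball_zero_iff.mp hz₀1))
      have := hd2.continuousAt.norm.continuousWithinAt.closure_le hmem
        continuousWithinAt_const fun z hz => (hlt z hz).le
      linarith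
  have hω₀ne : ω z₀ ≠ 0 := norm_pos_iff.mp (by linarith)
  set v : ℂ := z₀ * deriv ω z₀ / ω z₀ with hv
  -- Along each curve `s ↦ exp (s * d)` the real part of `ω (z₀ * ζ) / ω z₀` is at most `‖ζ‖`,
  -- with equality at `s = 0`; the directions `d = I` and `d = 1` give `v.im = 0` and `1 ≤ v.re`.
  have hcurve : ∀ d : ℂ, HasDerivAt
      (fun s : ℝ => (ω (z₀ * exp (s * d)) / ω z₀).re - Real.exp (s * d.re))
      ((v * d).re - d.re) 0 := by
    intro d
    have h1 : HasDerivAt (fun s : ℂ => z₀ * exp (s * d)) (z₀ * d) 0 := by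
      have := (((hasDerivAt_id (0 : ℂ)).mul_const d).cexp).const_mul z₀
      simpa using this
    have h2 : HasDerivAt ω (deriv ω z₀) (z₀ * exp (0 * d)) := by
      simpa using hdiff.hasDerivAt
    have h3 := ((h2.comp (0 : ℂ) h1).div_const (ω z₀))
    have h4 : HasDerivAt (fun s : ℝ => (ω (z₀ * exp (s * d)) / ω z₀).re) (v * d).re 0 := by
      have := HasDerivAt.real_of_complex (z := 0) (e := fun s => ω (z₀ * exp (s * d)) / ω z₀)
        (e' := v * d) (by
          convert! h3 using 1
          rw [hv]; ring)
      exact this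
    have h5 : HasDerivAt (fun s : ℝ => Real.exp (s * d.re)) d.re 0 := by
      have := ((hasDerivAt_id (0 : ℝ)).mul_const d.re).exp
      simpa using this
    exact h4.sub h5
  have hcurve_le : ∀ (d : ℂ) (s : ℝ), s * d.re ≤ 0 →
      (ω (z₀ * exp (s * d)) / ω z₀).re - Real.exp (s * d.re) ≤ 0 := by
    intro d s hs
    have hn : ‖exp (s * d)‖ = Real.exp (s * d.re) := by rw [norm_exp]; simp
    have h1 := hschwarz (exp (s * d)) (by rw [hn]; simpa using hs)
    rw [hn] at h1
    have h2 := re_le_norm (ω (z₀ * exp (s * d)) / ω z₀)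
    rw [norm_div, hz₀eq, div_one] at h2
    linarith
  have hcurve_zero : ∀ d : ℂ,
      (ω (z₀ * exp ((0 : ℝ) * d)) / ω z₀).re - Real.exp ((0 : ℝ) * d.re) = 0 := by
    intro d
    simp [hω₀ne]
  have him : v.im = 0 := by
    have hmax : IsLocalMax
        (fun s : ℝ => (ω (z₀ * exp (s * I)) / ω z₀).re - Real.exp (s * I.re)) 0 := by
      refine Eventually.of_forall fun s => ?_
      beta_reduce
      rw [hcurve_zero I]
      exact hcurve_le I s (by simp)
    have := hmax.hasDerivAt_eq_zero (hcurve I)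
    simpa using this
  have hre : 1 ≤ v.re := by
    have hd := hcurve 1
    have : 0 ≤ (v * 1).re - (1 : ℂ).re := by
      have ht := (hasDerivAt_iff_tendsto_slope.mp hd).mono_left
        (nhdsWithin_mono (0 : ℝ) (show Iio (0 : ℝ) ⊆ {0}ᶜ from fun x hx => (ne_of_lt hx)))
      refine ge_of_tendsto ht ?_
      filter_upwards [self_mem_nhdsWithin] with s hs
      rw [slope_def_field, hcurve_zero 1]
      refine div_nonneg_of_nonpos ?_ ?_
      · have := hcurve_le 1 s (by simpa using (le_of_lt hs : s ≤ 0))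
        linarith
      · have : s < 0 := hs
        linarith
    simp at this
    linarith
  refine hne z₀ hz₀1 hz₀eq v.re hre ?_
  have hvr : ((v.re : ℝ) : ℂ) = v := Complex.ext (by simp) (by simp [him])
  rw [hvr, hv]
  field_simp

/-- If `z * P'(z)` is subordinate to `a * B * z / (1 + B * z)`, then `P` is subordinate to
`a * log (1 + B * z)`, the solution of the equation with `w z = z`. -/
theorem exists_eq_log_of_mul_deriv_eq {P w : ℂ → ℂ} {a B : ℝ} (ha : a ≠ 0) (hB : |B| < 1)
    (hB0 : B ≠ 0) (hP : DifferentiableOn ℂ P (ball 0 1)) (hP0 : P 0 = 0)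
    (hw : ∀ z ∈ ball (0 : ℂ) 1, ‖w z‖ < 1)
    (hPw : ∀ z ∈ ball (0 : ℂ) 1, z * deriv P z = a * (B * w z / (1 + B * w z))) :
    ∀ z ∈ ball (0 : ℂ) 1, ∃ x : ℂ, ‖x‖ < |B| ∧ P z = a * log (1 + x) := by
  have haC : (a : ℂ) ≠ 0 := ofReal_ne_zero.mpr ha
  have hBC : (B : ℂ) ≠ 0 := ofReal_ne_zero.mpr hB0
  have hBpos : 0 < |B| := abs_pos.mpr hB0
  set ω : ℂ → ℂ := fun z => (exp (P z / a) - 1) / B with hω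
  have hPd : ∀ z ∈ ball (0 : ℂ) 1, HasDerivAt P (deriv P z) z := fun z hz =>
    (hP.differentiableAt (isOpen_ball.mem_nhds hz)).hasDerivAt
  have hωd : ∀ z ∈ ball (0 : ℂ) 1, HasDerivAt ω (exp (P z / a) * (deriv P z / a) / B) z :=
    fun z hz => ((((hPd z hz).div_const (a : ℂ)).cexp).sub_const 1).div_const (B : ℂ)
  have hBω : ∀ z, 1 + B * ω z = exp (P z / a) := by
    intro z; rw [hω]; field_simp; ring
  have hden : ∀ z ∈ ball (0 : ℂ) 1, 1 + B * w z ≠ 0 := by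
    intro z hz h
    have h1 : ‖(B : ℂ) * w z‖ = 1 := by
      rw [show (B : ℂ) * w z = -1 by linear_combination h]; simp
    rw [norm_mul, norm_real, Real.norm_eq_abs] at h1
    nlinarith [hw z hz, norm_nonneg (w z)]
  have hωlt : ∀ z ∈ ball (0 : ℂ) 1, ‖ω z‖ < 1 := by
    refine norm_lt_one_of_forall_mul_deriv_ne
      (fun z hz => (hωd z hz).differentiableAt.differentiableWithinAt) (by simp [hω, hP0]) ?_
    intro z hz hωz k hk h
    rw [(hωd z hz).deriv, ← hBω z] at h
    have h1 : (k : ℂ) * ω z = w z * (1 - (k - 1) * (B * ω z)) := by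
      have h2 := hPw z hz
      have h3 := hden z hz
      have h4 : z * (deriv P z / a) = B * w z / (1 + B * w z) := by
        rw [← mul_div_assoc, h2]; field_simp
      have h5 : (1 + B * ω z) * (B * w z / (1 + B * w z)) / B = k * ω z := by
        rw [← h, ← h4]; ring
      field_simp at h5
      linear_combination -h5
    have h6 : ‖(k : ℂ) * ω z‖ = k := by
      rw [norm_mul, norm_real, hωz, Real.norm_of_nonneg (by linarith), mul_one]
    have h7 : ‖1 - ((k : ℂ) - 1) * (B * ω z)‖ ≤ k := by
      refine (norm_sub_le _ _).trans ?_
      rw [norm_mul, norm_mul, hωz, norm_real, Real.norm_eq_abs, norm_one, mul_one]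
      have : ‖(k : ℂ) - 1‖ = k - 1 := by
        rw [show (k : ℂ) - 1 = ((k - 1 : ℝ) : ℂ) by push_cast; ring, norm_real,
          Real.norm_of_nonneg (by linarith)]
      rw [this]
      nlinarith
    rw [h1, norm_mul] at h6
    nlinarith [hw z hz, norm_nonneg (w z)]
  intro z hz
  have hx : ∀ z ∈ ball (0 : ℂ) 1, ‖(B : ℂ) * ω z‖ < |B| := fun z hz => by
    rw [norm_mul, norm_real, Real.norm_eq_abs]
    exact mul_lt_of_lt_one_right hBpos (hωlt z hz)
  refine ⟨B * ω z, hx z hz, ?_⟩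
  have hslit : ∀ z ∈ ball (0 : ℂ) 1, exp (P z / a) ∈ slitPlane := fun z hz => by
    rw [← hBω z]
    exact mem_slitPlane_of_norm_lt_one ((hx z hz).trans hB)
  have hlog : EqOn (fun z => P z / a) (fun z => log (exp (P z / a))) (ball 0 1) := by
    refine isOpen_ball.eqOn_of_deriv_eq (convex_ball _ _).isPreconnected
      (hP.div_const _) (fun z hz => ?_) (fun z hz => ?_) (x := 0) (by simp) (by simp [hP0])
    · exact ((((hPd z hz).div_const (a : ℂ)).cexp).clog
        (hslit z hz)).differentiableAt.differentiableWithinAt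
    · rw [((hPd z hz).div_const (a : ℂ)).deriv,
        ((((hPd z hz).div_const (a : ℂ)).cexp).clog (hslit z hz)).deriv]
      rw [mul_div_cancel_left₀ _ (exp_ne_zero _)]
  have := hlog hz
  simp only at this
  rw [hBω z, ← this]
  field_simp

/-! ### Estimates for the logarithm and for powers on a disk -/

theorem re_one_add_pos {x : ℂ} (hx : ‖x‖ < 1) : 0 < (1 + x).re := by
  have := abs_le.mp (abs_re_le_norm x)
  rw [add_re, one_re]
  linarith

theorem log_one_add_div_one_sub {ζ : ℂ} (hζ : ‖ζ‖ < 1) :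
    log ((1 + ζ) / (1 - ζ)) = log (1 + ζ) - log (1 - ζ) := by
  have h1 := re_one_add_pos hζ
  have h2 := re_one_add_pos (x := -ζ) (by simpa using hζ)
  rw [← sub_eq_add_neg] at h2
  have h1' : 1 + ζ ≠ 0 := fun h => by simp [h] at h1
  have h2' : 1 - ζ ≠ 0 := fun h => by simp [h] at h2
  have ha1 := abs_lt.mp (abs_arg_lt_pi_div_two_iff.mpr (Or.inl h1))
  have ha2 := abs_lt.mp (abs_arg_lt_pi_div_two_iff.mpr (Or.inl h2))
  have hexp : exp (log (1 + ζ) - log (1 - ζ)) = (1 + ζ) / (1 - ζ) := by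
    rw [exp_sub, exp_log h1', exp_log h2']
  rw [← hexp, log_exp]
  · rw [sub_im, log_im, log_im]; linarith
  · rw [sub_im, log_im, log_im]; linarith

/-- `2 * artanh` has nonnegative power series coefficients, so its modulus on a circle is largest
at the positive real point; here this is read off from the derivative along a radius. -/
theorem norm_log_one_add_sub_log_one_sub_le {ζ : ℂ} {τ : ℝ} (hζ : ‖ζ‖ ≤ τ) (hτ : τ < 1) :
    ‖log (1 + ζ) - log (1 - ζ)‖ ≤ Real.log (1 + τ) - Real.log (1 - τ) := by
  have hτ0 : 0 ≤ τ := (norm_nonneg ζ).trans hζ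
  have hmem : ∀ t ∈ Icc (0 : ℝ) 1, ‖(t : ℂ) * ζ‖ < 1 := fun t ht => by
    rw [norm_mul, norm_real, Real.norm_of_nonneg ht.1]
    nlinarith [ht.1, ht.2, norm_nonneg ζ]
  have hd : ∀ t ∈ Icc (0 : ℝ) 1, HasDerivAt
      (fun t : ℝ => log (1 + t * ζ) - log (1 - t * ζ)) (ζ / (1 + t * ζ) - -ζ / (1 - t * ζ)) t := by
    intro t ht
    have h1 : HasDerivAt (fun t : ℝ => (t : ℂ) * ζ) ζ t := by
      simpa using (ofRealCLM.hasDerivAt (x := t)).mul_const ζ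
    refine ((h1.const_add 1).clog_real ?_).sub ((h1.const_sub 1).clog_real ?_)
    · exact mem_slitPlane_of_norm_lt_one (hmem t ht)
    · rw [sub_eq_add_neg]
      exact mem_slitPlane_of_norm_lt_one (by rw [norm_neg]; exact hmem t ht)
  have hdB : ∀ t ∈ Icc (0 : ℝ) 1, HasDerivAt
      (fun t : ℝ => Real.log (1 + t * τ) - Real.log (1 - t * τ))
      (τ / (1 + t * τ) - -τ / (1 - t * τ)) t := by
    intro t ht
    have h1 : HasDerivAt (fun t : ℝ => t * τ) τ t := by
      simpa using (hasDerivAt_id t).mul_const τ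
    refine ((h1.const_add 1).log ?_).sub ((h1.const_sub 1).log ?_)
    · nlinarith [ht.1, ht.2]
    · nlinarith [ht.1, ht.2]
  have := image_norm_le_of_norm_deriv_right_le_deriv_boundary' (a := 0) (b := 1)
    (fun t ht => (hd t ht).continuousAt.continuousWithinAt)
    (fun t ht => (hd t (Ico_subset_Icc_self ht)).hasDerivWithinAt) (by simp)
    (fun t ht => (hdB t ht).continuousAt.continuousWithinAt)
    (fun t ht => (hdB t (Ico_subset_Icc_self ht)).hasDerivWithinAt) ?_
    (right_mem_Icc.mpr zero_le_one)
  · simpa using this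
  · intro t ht'
    have ht := Ico_subset_Icc_self ht'
    have htτ : t * τ < 1 := by nlinarith [ht.1, ht.2]
    have htτ0 : 0 ≤ t * τ := mul_nonneg ht.1 hτ0
    have hle : ‖(t : ℂ) * ζ‖ ≤ t * τ := by
      rw [norm_mul, norm_real, Real.norm_of_nonneg ht.1]
      exact mul_le_mul_of_nonneg_left hζ ht.1
    have h1 : 1 + (t : ℂ) * ζ ≠ 0 := fun h => by simpa [h] using re_one_add_pos (hmem t ht)
    have h2 : 1 - (t : ℂ) * ζ ≠ 0 := fun h => by
      have := re_one_add_pos (x := -((t : ℂ) * ζ)) (by rw [norm_neg]; exact hmem t ht)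
      rw [← sub_eq_add_neg, h] at this
      simp at this
    have e1 : ζ / (1 + t * ζ) - -ζ / (1 - t * ζ) = 2 * ζ / (1 - (t * ζ) ^ 2) := by
      rw [div_sub_div _ _ h1 h2]
      congr 1 <;> ring
    have e2 : τ / (1 + t * τ) - -τ / (1 - t * τ) = 2 * τ / (1 - (t * τ) ^ 2) := by
      rw [div_sub_div _ _ (by linarith) (by linarith)]
      congr 1 <;> ring
    rw [e1, e2, norm_div, norm_mul]
    have h3 : 1 - (t * τ) ^ 2 ≤ ‖1 - ((t : ℂ) * ζ) ^ 2‖ := by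
      have := norm_sub_norm_le (1 : ℂ) (((t : ℂ) * ζ) ^ 2)
      rw [norm_one, norm_pow] at this
      nlinarith [norm_nonneg ((t : ℂ) * ζ)]
    have h4 : 0 < 1 - (t * τ) ^ 2 := by nlinarith
    rw [show ‖(2 : ℂ)‖ = 2 by simp]
    gcongr

/-- The image of the disk `‖x‖ ≤ b` under `x ↦ log (1 + x)` lies in the disk that has the image
`[log (1 - b), log (1 + b)]` of the real diameter as a diameter. The disk `‖s - 1‖ ≤ b` is a
hyperbolic disk of the right half-plane with centre `√(1 - b ^ 2)`, and the hyperbolic length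
element `|ds| / s.re` dominates `|ds| / |s| = |d log s|`. The proof uses the coordinate `ζ` with
`s = √(1 - b ^ 2) * (1 + ζ) / (1 - ζ)`, in which the hyperbolic disk is centred at `0`. -/
theorem norm_log_one_add_sub_le {x : ℂ} {b : ℝ} (hx : ‖x‖ ≤ b) (hb : b < 1) :
    ‖log (1 + x) - ((Real.log (1 + b) + Real.log (1 - b)) / 2 : ℝ)‖
      ≤ (Real.log (1 + b) - Real.log (1 - b)) / 2 := by
  have hb0 : 0 ≤ b := (norm_nonneg x).trans hx
  set L := (Real.log (1 + b) + Real.log (1 - b)) / 2 with hL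
  set s₀ := Real.exp L with hs₀
  have hs₀pos : 0 < s₀ := Real.exp_pos L
  have hs₀sq : s₀ ^ 2 = 1 - b ^ 2 := by
    rw [hs₀, ← Real.exp_nat_mul, hL]
    rw [show ((2 : ℕ) : ℝ) * ((Real.log (1 + b) + Real.log (1 - b)) / 2)
      = Real.log (1 + b) + Real.log (1 - b) by push_cast; ring, Real.exp_add,
      Real.exp_log (by linarith), Real.exp_log (by linarith)]
    ring
  have hs₀le : s₀ ≤ 1 := by nlinarith
  set s : ℂ := 1 + x with hs
  have hsre : 0 < s.re := re_one_add_pos (hx.trans_lt hb)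
  have hsum : s + s₀ ≠ 0 := fun h => by
    have := congrArg re h
    simp at this
    linarith
  set ζ : ℂ := (s - s₀) / (s + s₀) with hζ
  set τ : ℝ := (1 + b - s₀) / (1 + b + s₀) with hτ
  have hτden : 0 < 1 + b + s₀ := by linarith
  have hτ0 : 0 ≤ τ := div_nonneg (by linarith) hτden.le
  have hτ1 : τ < 1 := by rw [hτ, div_lt_one hτden]; linarith
  have hζτ : ‖ζ‖ ≤ τ := by
    have hN : s.re * s.re + s.im * s.im + s₀ ^ 2 ≤ 2 * s.re := by
      have h1 : ‖x‖ ^ 2 ≤ b ^ 2 := by gcongr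
      have hxs : x = s - 1 := by rw [hs]; ring
      rw [hxs, ← normSq_eq_norm_sq, normSq_apply] at h1
      simp only [sub_re, one_re, sub_im, one_im] at h1
      rw [hs₀sq]
      linarith
    have hnum : ‖s - s₀‖ ^ 2 = s.re * s.re + s.im * s.im + s₀ ^ 2 - 2 * s₀ * s.re := by
      rw [← normSq_eq_norm_sq, normSq_apply]; simp; ring
    have hden : ‖s + s₀‖ ^ 2 = s.re * s.re + s.im * s.im + s₀ ^ 2 + 2 * s₀ * s.re := by
      rw [← normSq_eq_norm_sq, normSq_apply]; simp; ring
    have hτsq : τ ^ 2 = (1 - s₀) / (1 + s₀) := by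
      have h1 : 1 + s₀ ≠ 0 := by linarith
      rw [hτ, div_pow, div_eq_div_iff (by positivity) h1]
      linear_combination (2 * s₀) * hs₀sq
    rw [← abs_of_nonneg hτ0, ← abs_of_nonneg (norm_nonneg ζ), ← sq_le_sq, hτsq, hζ, norm_div,
      div_pow, div_le_div_iff₀ (by positivity) (by positivity), hnum, hden]
    nlinarith [mul_le_mul_of_nonneg_left hN hs₀pos.le]
  have hζ1 : ‖ζ‖ < 1 := hζτ.trans_lt hτ1
  have hmob : s = s₀ * ((1 + ζ) / (1 - ζ)) := by
    have hs₀C : (s₀ : ℂ) ≠ 0 := ofReal_ne_zero.mpr hs₀pos.ne'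
    have e1 : 1 + ζ = 2 * s / (s + s₀) := by rw [hζ]; field_simp; ring
    have e2 : 1 - ζ = 2 * s₀ / (s + s₀) := by rw [hζ]; field_simp; ring
    rw [e1, e2]
    field_simp
  have hne : (1 + ζ) / (1 - ζ) ≠ 0 := fun h => by
    rw [h, mul_zero] at hmob
    simp [hmob] at hsre
  have hlog : log s - L = log (1 + ζ) - log (1 - ζ) := by
    rw [hmob, log_ofReal_mul hs₀pos hne, log_one_add_div_one_sub hζ1, hs₀, Real.log_exp]
    ring
  rw [hlog]
  refine (norm_log_one_add_sub_log_one_sub_le hζτ hτ1).trans (le_of_eq ?_)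
  rw [← Real.log_div (by linarith) (by linarith)]
  have : (1 + τ) / (1 - τ) = (1 + b) / s₀ := by
    have e1 : 1 + τ = 2 * (1 + b) / (1 + b + s₀) := by rw [hτ]; field_simp; ring
    have e2 : 1 - τ = 2 * s₀ / (1 + b + s₀) := by rw [hτ]; field_simp; ring
    rw [e1, e2]
    field_simp
  rw [this, Real.log_div (by linarith) hs₀pos.ne', hs₀, Real.log_exp, hL]
  ring

/-- If the real interval with endpoints `a * log (1 ± B)` lies in `[-α, γ]`, then all values
`a * log (1 + x)` with `‖x‖ ≤ |B|` lie in the disk with diameter `[-α, γ]`. -/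
theorem norm_mul_log_one_add_sub_le {a B α γ : ℝ} (haB : 0 < a * B) (hB : |B| < 1)
    (hα : -α ≤ a * Real.log (1 - B)) (hγ : a * Real.log (1 + B) ≤ γ) {x : ℂ} (hx : ‖x‖ ≤ |B|) :
    ‖a * log (1 + x) - ((γ - α) / 2 : ℝ)‖ ≤ (γ + α) / 2 := by
  set m := a * (Real.log (1 + B) + Real.log (1 - B)) / 2 with hm
  have h1 : ‖a * log (1 + x) - (m : ℂ)‖ ≤ a * (Real.log (1 + B) - Real.log (1 - B)) / 2 := by
    have h := mul_le_mul_of_nonneg_left (norm_log_one_add_sub_le hx hB) (abs_nonneg a)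
    have e1 : Real.log (1 + |B|) + Real.log (1 - |B|) = Real.log (1 + B) + Real.log (1 - B) := by
      rcases abs_choice B with h3 | h3 <;> rw [h3]
      rw [sub_neg_eq_add, ← sub_eq_add_neg, add_comm]
    have e2 : |a| * (Real.log (1 + |B|) - Real.log (1 - |B|))
        = a * (Real.log (1 + B) - Real.log (1 - B)) := by
      rcases pos_and_pos_or_neg_and_neg_of_mul_pos haB with ⟨h3, h4⟩ | ⟨h3, h4⟩
      · rw [abs_of_pos h3, abs_of_pos h4]
      · rw [abs_of_neg h3, abs_of_neg h4, sub_neg_eq_add, ← sub_eq_add_neg]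
        ring
    rw [← mul_div_assoc, e2, e1, ← Real.norm_eq_abs, ← norm_real, ← norm_mul] at h
    refine le_trans (le_of_eq ?_) h
    rw [hm]
    push_cast
    ring_nf
  have h2 : a * log (1 + x) - (((γ - α) / 2 : ℝ) : ℂ)
      = (a * log (1 + x) - (m : ℂ)) + ((m - (γ - α) / 2 : ℝ) : ℂ) := by push_cast; ring
  have h3 : |m - (γ - α) / 2|
      ≤ (γ + α) / 2 - a * (Real.log (1 + B) - Real.log (1 - B)) / 2 := by
    rw [abs_le, hm]
    constructor <;> linarith
  rw [h2]
  refine (norm_add_le _ _).trans ?_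
  rw [norm_real, Real.norm_eq_abs]
  linarith

/-- The distance of the power `(1 + x) ^ a` from `1`, for `‖x‖ ≤ |c|`, is largest at the real
point `c`, provided `c` has the sign of `a - 1`: then `|s ^ (a - 1)|` is largest at `s = 1 + c`,
and one compares derivatives along radii. -/
theorem norm_exp_mul_log_one_add_sub_one_le {a c : ℝ} (hc : |c| < 1) (hc0 : c ≠ 0)
    (hac : 0 ≤ (a - 1) * c) {x : ℂ} (hx : ‖x‖ ≤ |c|) :
    ‖exp (a * log (1 + x)) - 1‖ ≤ |Real.exp (a * Real.log (1 + c)) - 1| := by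
  have hmem : ∀ t ∈ Icc (0 : ℝ) 1, ‖(t : ℂ) * x‖ < 1 := fun t ht => by
    rw [norm_mul, norm_real, Real.norm_of_nonneg ht.1]
    nlinarith [ht.1, ht.2, norm_nonneg x]
  have hcpos : ∀ t ∈ Icc (0 : ℝ) 1, 0 < 1 + t * c := fun t ht => by
    nlinarith [ht.1, ht.2, abs_lt.mp hc]
  have hd : ∀ t ∈ Icc (0 : ℝ) 1, HasDerivAt (fun t : ℝ => exp (a * log (1 + t * x)) - 1)
      (exp (a * log (1 + t * x)) * (a * (x / (1 + t * x)))) t := by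
    intro t ht
    have h1 : HasDerivAt (fun t : ℝ => (t : ℂ) * x) x t := by
      simpa using (ofRealCLM.hasDerivAt (x := t)).mul_const x
    exact ((((h1.const_add 1).clog_real (mem_slitPlane_of_norm_lt_one (hmem t ht))).const_mul
      (a : ℂ)).cexp).sub_const 1
  set σ : ℝ := ((SignType.sign (a * c) : SignType) : ℝ) with hσ
  have hdB : ∀ t ∈ Icc (0 : ℝ) 1, HasDerivAt
      (fun t : ℝ => σ * (Real.exp (a * Real.log (1 + t * c)) - 1))
      (σ * (Real.exp (a * Real.log (1 + t * c)) * (a * (c / (1 + t * c))))) t := by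
    intro t ht
    have h1 : HasDerivAt (fun t : ℝ => t * c) c t := by
      simpa using (hasDerivAt_id t).mul_const c
    exact (((((h1.const_add 1).log (hcpos t ht).ne').const_mul a).exp).sub_const 1).const_mul σ
  have := image_norm_le_of_norm_deriv_right_le_deriv_boundary' (a := 0) (b := 1)
    (fun t ht => (hd t ht).continuousAt.continuousWithinAt)
    (fun t ht => (hd t (Ico_subset_Icc_self ht)).hasDerivWithinAt) (by simp)
    (fun t ht => (hdB t ht).continuousAt.continuousWithinAt)
    (fun t ht => (hdB t (Ico_subset_Icc_self ht)).hasDerivWithinAt) ?_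
    (right_mem_Icc.mpr zero_le_one)
  · simp only [ofReal_one, one_mul] at this
    refine this.trans ((le_abs_self _).trans ?_)
    rw [abs_mul]
    refine mul_le_of_le_one_left (abs_nonneg _) ?_
    rw [hσ]
    generalize SignType.sign (a * c) = τ
    cases τ <;> simp
  · intro t ht'
    have ht := Ico_subset_Icc_self ht'
    have hne : 1 + (t : ℂ) * x ≠ 0 := fun h => by simpa [h] using re_one_add_pos (hmem t ht)
    have hnpos : 0 < ‖1 + (t : ℂ) * x‖ := norm_pos_iff.mpr hne
    have hle : ‖(t : ℂ) * x‖ ≤ t * |c| := by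
      rw [norm_mul, norm_real, Real.norm_of_nonneg ht.1]
      exact mul_le_mul_of_nonneg_left hx ht.1
    have hnorm : ‖exp (a * log (1 + t * x)) * (a * (x / (1 + t * x)))‖
        = |a| * ‖x‖ * Real.exp ((a - 1) * Real.log ‖1 + (t : ℂ) * x‖) := by
      rw [norm_mul, norm_exp, re_ofReal_mul, log_re, norm_mul, norm_div, norm_real,
        Real.norm_eq_abs, sub_mul, one_mul, Real.exp_sub, Real.exp_log hnpos]
      ring
    have hB : σ * (Real.exp (a * Real.log (1 + t * c)) * (a * (c / (1 + t * c))))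
        = |a| * |c| * Real.exp ((a - 1) * Real.log (1 + t * c)) := by
      rw [sub_mul, one_mul, Real.exp_sub, Real.exp_log (hcpos t ht), ← abs_mul,
        ← sign_mul_self (a * c), hσ]
      ring
    rw [hnorm, hB]
    gcongr ?_ * Real.exp ?_
    · gcongr
    · rcases lt_or_gt_of_ne hc0 with h | h
      · have h1 : 1 + t * c ≤ ‖1 + (t : ℂ) * x‖ := by
          have := norm_sub_norm_le (1 : ℂ) (-((t : ℂ) * x))
          rw [norm_one, norm_neg, sub_neg_eq_add] at this
          rw [abs_of_neg h] at hle
          linarith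
        exact mul_le_mul_of_nonpos_left (Real.log_le_log (hcpos t ht) h1) (by nlinarith)
      · have h1 : ‖1 + (t : ℂ) * x‖ ≤ 1 + t * c := by
          have := norm_add_le (1 : ℂ) ((t : ℂ) * x)
          rw [norm_one] at this
          rw [abs_of_pos h] at hle
          linarith
        exact mul_le_mul_of_nonneg_left (Real.log_le_log hnpos h1) (by nlinarith)

/-! ### Sufficiency -/

/-- If `p` vanished at `z₀`, comparing the orders of vanishing at `z₀` in `z * p' = p ^ j * h`
would give `ord p ≤ ord p - 1`. The equation is only assumed in the quotient form, which says
nothing at the zeros of `p` because division by zero gives zero. -/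
theorem IsNormalized.ne_zero_of_mul_deriv_div_pow_eq {p h : ℂ → ℂ} {j : ℕ} (hp : IsNormalized p)
    (hj : j ≠ 0) (hh : DifferentiableOn ℂ h (ball 0 1))
    (heq : ∀ z ∈ ball (0 : ℂ) 1, z * deriv p z / p z ^ j = h z) :
    ∀ z ∈ ball (0 : ℂ) 1, p z ≠ 0 := by
  intro z₀ hz₀ hpz₀
  have hpan : AnalyticOnNhd ℂ p (ball 0 1) := hp.1.analyticOnNhd isOpen_ball
  have hpa : AnalyticAt ℂ p z₀ := hpan z₀ hz₀
  have hha : AnalyticAt ℂ h z₀ := hh.analyticOnNhd isOpen_ball z₀ hz₀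
  have hz₀ne : z₀ ≠ 0 := by
    rintro rfl
    rw [hp.2] at hpz₀
    exact one_ne_zero hpz₀
  have hnz : ¬ ∀ᶠ z in 𝓝 z₀, p z = 0 := by
    intro hz
    have := hpan.eqOn_zero_of_preconnected_of_eventuallyEq_zero
      (convex_ball _ _).isPreconnected hz₀ hz (mem_ball_self one_pos)
    rw [hp.2] at this
    exact one_ne_zero this
  obtain ⟨i, rfl⟩ := Nat.exists_eq_succ_of_ne_zero hj
  have hev : (fun z => z * deriv p z) =ᶠ[𝓝 z₀] fun z => p z * (p z ^ i * h z) := by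
    have hl : ContinuousAt (fun z => z * deriv p z) z₀ :=
      continuousAt_id.mul hpa.deriv.continuousAt
    have hr : ContinuousAt (fun z => p z * (p z ^ i * h z)) z₀ :=
      hpa.continuousAt.mul ((hpa.continuousAt.pow i).mul hha.continuousAt)
    rw [← hl.eventuallyEq_nhds_iff_eventuallyEq_nhdsNE hr]
    filter_upwards [hpa.eventually_eq_zero_or_eventually_ne_zero.resolve_left hnz,
      nhdsWithin_le_nhds (isOpen_ball.mem_nhds hz₀)] with z hz hzb
    rw [← heq z hzb, pow_succ]
    field_simp
  have hid : analyticOrderAt (fun z : ℂ => z) z₀ = 0 := by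
    exact (AnalyticAt.analyticOrderAt_eq_zero (f := fun z : ℂ => z) analyticAt_id).mpr hz₀ne
  have hord := analyticOrderAt_congr hev
  have h1 : analyticOrderAt (fun z => z * deriv p z) z₀ = analyticOrderAt (deriv p) z₀ := by
    have := analyticOrderAt_mul (f := fun z : ℂ => z) analyticAt_id hpa.deriv
    rw [hid, zero_add] at this
    exact this
  have h2 : analyticOrderAt (fun z => p z * (p z ^ i * h z)) z₀
      = analyticOrderAt p z₀ + analyticOrderAt (fun z => p z ^ i * h z) z₀ :=
    analyticOrderAt_mul hpa ((hpa.pow i).mul hha)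
  have h3 := hpa.analyticOrderAt_deriv_add_one
  simp only [hpz₀, sub_zero] at h3
  have htop : analyticOrderAt p z₀ ≠ ⊤ := fun h => hnz (analyticOrderAt_eq_top.mp h)
  rw [h1, h2] at hord
  have hle : analyticOrderAt p z₀ ≤ analyticOrderAt (deriv p) z₀ := hord ▸ le_self_add
  rw [← h3] at hle htop
  generalize analyticOrderAt (deriv p) z₀ = n at hle htop
  cases n with
  | top => simp at htop
  | coe n =>
    have : n + 1 ≤ n := by exact_mod_cast hle
    omega

theorem one_add_mul_ne_zero {B : ℝ} (hB : |B| < 1) {u : ℂ} (hu : ‖u‖ < 1) : 1 + B * u ≠ 0 := by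
  have h : ‖(B : ℂ) * u‖ < 1 := by
    rw [norm_mul, norm_real, Real.norm_eq_abs]
    nlinarith [norm_nonneg u, abs_nonneg B]
  intro h0
  simpa [h0] using re_one_add_pos h

/-- The differential subordination, solved for the quotient `z * p' / p ^ j`. -/
theorem subordinate_diffExpr_iff {A B β : ℝ} (hB : |B| < 1) (hB0 : B ≠ 0) (hβ : β ≠ 0) {j : ℕ}
    {p : ℂ → ℂ} :
    Subordinate (diffExpr β j p) (janowski A B) ↔
      ∃ w : ℂ → ℂ, DifferentiableOn ℂ w (ball 0 1) ∧ w 0 = 0 ∧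
        (∀ z ∈ ball (0 : ℂ) 1, ‖w z‖ < 1) ∧
        ∀ z ∈ ball (0 : ℂ) 1, z * deriv p z / p z ^ j
          = ((A - B) / (β * B) : ℝ) * (B * w z / (1 + B * w z)) := by
  have hBC : (B : ℂ) ≠ 0 := ofReal_ne_zero.mpr hB0
  have hβC : (β : ℂ) ≠ 0 := ofReal_ne_zero.mpr hβ
  unfold Subordinate
  refine exists_congr fun w => and_congr_right fun _ => and_congr_right fun _ =>
    and_congr_right fun hw => forall₂_congr fun z hz => ?_
  have hne := one_add_mul_ne_zero hB (hw z hz)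
  have h1 : janowski A B (w z)
      = 1 + β * (((A - B) / (β * B) : ℝ) * (B * w z / (1 + B * w z))) := by
    have e : (β : ℂ) * (((A - B) / (β * B) : ℝ) * (B * w z / (1 + B * w z)))
        = (A - B) * w z / (1 + B * w z) := by
      generalize 1 + (B : ℂ) * w z = d
      push_cast
      field_simp
    rw [e, janowski, div_eq_iff hne, add_mul, div_mul_cancel₀ _ hne]
    ring
  rw [h1, diffExpr, add_right_inj, mul_right_inj' hβC]

theorem differentiableOn_mul_div_one_add_mul {a B : ℝ} (hB : |B| < 1) {w : ℂ → ℂ}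
    (hw : DifferentiableOn ℂ w (ball 0 1)) (hw1 : ∀ z ∈ ball (0 : ℂ) 1, ‖w z‖ < 1) :
    DifferentiableOn ℂ (fun z => (a : ℂ) * (B * w z / (1 + B * w z))) (ball 0 1) :=
  ((hw.const_mul _).div ((hw.const_mul _).const_add _)
    fun z hz => one_add_mul_ne_zero hB (hw1 z hz)).const_mul _

/-- The conclusion `p ≺ nephroid` for the exponent `j`, whenever the real values
`a * log (1 - B)` and `a * log (1 + B)`, `a = (A - B) / (β * B)`, lie in `[-α, γ]`. -/
def EndpointSufficient (A B : ℝ) (j : ℕ) (α γ : ℝ) : Prop :=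
  ∀ β : ℝ, 0 < β → -α ≤ (A - B) / (β * B) * Real.log (1 - B) →
    (A - B) / (β * B) * Real.log (1 + B) ≤ γ → ∀ p : ℂ → ℂ, IsNormalized p →
      Subordinate (diffExpr β j p) (janowski A B) → Subordinate p nephroid

theorem div_mul_mul_self_pos {A B β : ℝ} (hB0 : B ≠ 0) (hBA : B < A) (hβ : 0 < β) :
    0 < (A - B) / (β * B) * B := by
  have : (A - B) / (β * B) * B = (A - B) / β := by field_simp
  rw [this]
  exact div_pos (sub_pos.mpr hBA) hβ

theorem endpointSufficient_zero {A B : ℝ} (hB : |B| < 1) (hB0 : B ≠ 0) (hBA : B < A) :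
    EndpointSufficient A B 0 (2 / 3) (2 / 3) := by
  intro β hβ hα hγ p hp hsub
  obtain ⟨w, -, -, hw1, hw⟩ := (subordinate_diffExpr_iff hB hB0 hβ.ne').mp hsub
  have haB := div_mul_mul_self_pos hB0 hBA hβ
  refine subordinate_nephroid_of_norm_sub_one_le hp fun z hz => ?_
  obtain ⟨x, hx, hP⟩ := exists_eq_log_of_mul_deriv_eq (P := fun z => p z - 1)
    (left_ne_zero_of_mul haB.ne') hB hB0 (hp.1.sub_const 1) (by simp [hp.2]) hw1
    (fun z hz => by simpa using hw z hz) z hz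
  rw [hP]
  have := norm_mul_log_one_add_sub_le haB hB hα hγ hx.le
  norm_num at this ⊢
  exact this

theorem endpointSufficient_one {A B : ℝ} (hB : |B| < 1) (hB0 : B ≠ 0) (hBA : B < A) :
    EndpointSufficient A B 1 (Real.log 3) (Real.log (5 / 3)) := by
  intro β hβ hα hγ p hp hsub
  obtain ⟨w, hwd, -, hw1, hw⟩ := (subordinate_diffExpr_iff hB hB0 hβ.ne').mp hsub
  have haB := div_mul_mul_self_pos hB0 hBA hβ
  set a := (A - B) / (β * B) with ha
  have hp0 := hp.ne_zero_of_mul_deriv_div_pow_eq one_ne_zero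
    (differentiableOn_mul_div_one_add_mul hB hwd hw1) hw
  simp only [pow_one] at hw
  obtain ⟨P, hP0, hP⟩ := (((hp.1.deriv isOpen_ball).div hp.1 hp0).isExactOn_ball).with_val_at 0 0
  have hpd : ∀ z ∈ ball (0 : ℂ) 1, HasDerivAt p (deriv p z) z := fun z hz =>
    (hp.1.differentiableAt (isOpen_ball.mem_nhds hz)).hasDerivAt
  have hexp : ∀ z ∈ ball (0 : ℂ) 1, p z = exp (P z) := by
    intro z hz
    have hd : ∀ z ∈ ball (0 : ℂ) 1, HasDerivAt (fun z => p z * exp (-P z)) 0 z := by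
      intro z hz
      refine ((hpd z hz).mul (hP z hz).neg.cexp).congr_deriv ?_
      have := hp0 z hz
      simp only [Pi.div_apply]
      field_simp
      ring
    have := isOpen_ball.is_const_of_deriv_eq_zero (convex_ball _ _).isPreconnected
      (fun z hz => (hd z hz).differentiableAt.differentiableWithinAt)
      (fun z hz => (hd z hz).deriv) hz (mem_ball_self one_pos)
    simp only [hP0, hp.2, neg_zero, exp_zero, mul_one] at this
    rw [exp_neg] at this
    field_simp at this
    exact this
  refine subordinate_nephroid_of_norm_sub_one_le hp fun z hz => ?_
  obtain ⟨x, hx, hPx⟩ := exists_eq_log_of_mul_deriv_eq (left_ne_zero_of_mul haB.ne') hB hB0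
    (fun z hz => (hP z hz).differentiableAt.differentiableWithinAt) hP0 hw1
    (fun z hz => by rw [(hP z hz).deriv, ← hw z hz, Pi.div_apply, mul_div_assoc]) z hz
  rw [hexp z hz, hPx]
  have hend : ∀ c, c = B ∨ c = -B → |Real.exp (a * Real.log (1 + c)) - 1| ≤ 2 / 3 := by
    have hlog : Real.log (1 - B) * B < 0 ∧ 0 < Real.log (1 + B) * B := by
      have := abs_lt.mp hB
      rcases lt_or_gt_of_ne hB0 with h | h
      · exact ⟨mul_neg_of_pos_of_neg (Real.log_pos (by linarith)) h,
          mul_pos_of_neg_of_neg (Real.log_neg (by linarith) (by linarith)) h⟩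
      · exact ⟨mul_neg_of_neg_of_pos (Real.log_neg (by linarith) (by linarith)) h,
          mul_pos (Real.log_pos (by linarith)) h⟩
    have hBsq : 0 < B ^ 2 := by positivity
    have h53 : (0 : ℝ) < Real.log (5 / 3) := Real.log_pos (by norm_num)
    have h3 : (0 : ℝ) < Real.log 3 := Real.log_pos (by norm_num)
    have hkey : ∀ y, -Real.log 3 ≤ y → y ≤ Real.log (5 / 3) → |Real.exp y - 1| ≤ 2 / 3 := by
      intro y h1 h2
      have h1' := Real.exp_le_exp.mpr h1
      have h2' := Real.exp_le_exp.mpr h2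
      rw [Real.exp_neg, Real.exp_log (by norm_num)] at h1'
      rw [Real.exp_log (by norm_num)] at h2'
      rw [abs_le]
      constructor <;> linarith
    rintro c (rfl | rfl)
    · refine hkey _ ?_ hγ
      have : 0 < a * Real.log (1 + c) := by
        by_contra! h
        nlinarith [mul_pos haB hlog.2]
      linarith
    · rw [← sub_eq_add_neg]
      refine hkey _ hα ?_
      have : a * Real.log (1 - B) < 0 := by
        by_contra! h
        nlinarith [mul_pos haB (neg_pos.mpr hlog.1)]
      linarith
  -- The extremal endpoint `c = ± B` is the one with the sign of `a - 1`.
  rcases le_total 0 ((a - 1) * B) with h | h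
  · exact (norm_exp_mul_log_one_add_sub_one_le hB hB0 h hx.le).trans (hend B (Or.inl rfl))
  · exact (norm_exp_mul_log_one_add_sub_one_le (c := -B) (by rwa [abs_neg]) (neg_ne_zero.mpr hB0)
      (by linarith) (by rw [abs_neg]; exact hx.le)).trans (hend (-B) (Or.inr rfl))

/-- The Möbius map `u ↦ 1 / (1 - u)` takes the disk with diameter `[-2, 2 / 5]` to the disk with
diameter `[1 / 3, 5 / 3]`. -/
theorem norm_inv_one_sub_sub_one_le {u : ℂ} (hu : ‖u + 4 / 5‖ ≤ 6 / 5) :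
    ‖(1 - u)⁻¹ - 1‖ ≤ 2 / 3 := by
  have h1 : ‖u + 4 / 5‖ ^ 2 ≤ (6 / 5) ^ 2 := by gcongr
  have hne : 1 - u ≠ 0 := by
    intro h
    rw [← sub_eq_zero.mp h] at hu
    norm_num at hu
  have e : (1 - u)⁻¹ - 1 = u / (1 - u) := by field_simp; ring
  rw [e, norm_div, div_le_iff₀ (norm_pos_iff.mpr hne)]
  have h2 : ‖u + 4 / 5‖ ^ 2 = u.re * u.re + u.im * u.im + 8 / 5 * u.re + 16 / 25 := by
    rw [← normSq_eq_norm_sq, normSq_apply]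
    simp
    ring
  have h3 : ‖1 - u‖ ^ 2 = u.re * u.re + u.im * u.im - 2 * u.re + 1 := by
    rw [← normSq_eq_norm_sq, normSq_apply]
    simp
    ring
  have h4 : ‖u‖ ^ 2 = u.re * u.re + u.im * u.im := by
    rw [← normSq_eq_norm_sq, normSq_apply]
  refine (sq_le_sq₀ (norm_nonneg _) (by positivity)).mp ?_
  rw [mul_pow, h3, h4]
  rw [h2] at h1
  linarith

theorem endpointSufficient_two {A B : ℝ} (hB : |B| < 1) (hB0 : B ≠ 0) (hBA : B < A) :
    EndpointSufficient A B 2 2 (2 / 5) := by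
  intro β hβ hα hγ p hp hsub
  obtain ⟨w, hwd, -, hw1, hw⟩ := (subordinate_diffExpr_iff hB hB0 hβ.ne').mp hsub
  have haB := div_mul_mul_self_pos hB0 hBA hβ
  have hp0 := hp.ne_zero_of_mul_deriv_div_pow_eq two_ne_zero
    (differentiableOn_mul_div_one_add_mul hB hwd hw1) hw
  have hP : ∀ z ∈ ball (0 : ℂ) 1, HasDerivAt (fun z => 1 - (p z)⁻¹) (deriv p z / p z ^ 2) z := by
    intro z hz
    have := ((hp.1.differentiableAt (isOpen_ball.mem_nhds hz)).hasDerivAt.fun_inv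
      (hp0 z hz)).const_sub 1
    exact this.congr_deriv (by ring)
  refine subordinate_nephroid_of_norm_sub_one_le hp fun z hz => ?_
  obtain ⟨x, hx, hPx⟩ := exists_eq_log_of_mul_deriv_eq (left_ne_zero_of_mul haB.ne') hB hB0
    (fun z hz => (hP z hz).differentiableAt.differentiableWithinAt) (by simp [hp.2]) hw1
    (fun z hz => by rw [(hP z hz).deriv, ← hw z hz, mul_div_assoc]) z hz
  have h := norm_mul_log_one_add_sub_le haB hB hα hγ hx.le
  rw [← hPx] at h
  have h2 := norm_inv_one_sub_sub_one_le (u := 1 - (p z)⁻¹) (by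
    norm_num at h ⊢
    exact h)
  simpa using h2

/-! ### Failure for smaller `β` -/

/-- For the exponent `j` the implication fails for each `β > 0` for which `a * log (1 - B)` or
`a * log (1 + B)`, `a = (A - B) / (β * B)`, lies outside `[-α, γ]`. -/
def EndpointNecessary (A B : ℝ) (j : ℕ) (α γ : ℝ) : Prop :=
  ∀ β : ℝ, 0 < β → ((A - B) / (β * B) * Real.log (1 - B) < -α ∨
    γ < (A - B) / (β * B) * Real.log (1 + B)) → ∃ p : ℂ → ℂ, IsNormalized p ∧
    (j ≠ 0 → ∀ z ∈ ball (0 : ℂ) 1, p z ≠ 0) ∧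
    Subordinate (diffExpr β j p) (janowski A B) ∧ ¬ Subordinate p nephroid

theorem ofReal_mem_unitBall {x : ℝ} (h1 : -1 < x) (h2 : x < 1) : (x : ℂ) ∈ ball (0 : ℂ) 1 := by
  rw [mem_ball_zero_iff, norm_real, Real.norm_eq_abs, abs_lt]
  exact ⟨h1, h2⟩

theorem exists_lt_mul_log {a c γ : ℝ} (hc : |c| < 1) (h : γ < a * Real.log (1 + c)) :
    ∃ x : ℝ, -1 < x ∧ x < 1 ∧ γ < a * Real.log (1 + c * x) := by
  have hpos : 1 + c * 1 ≠ 0 := by linarith [(abs_lt.mp hc).1]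
  have hcont : ContinuousAt (fun x : ℝ => a * Real.log (1 + c * x)) 1 :=
    continuousAt_const.mul (ContinuousAt.log (by fun_prop) hpos)
  have hev := (hcont.eventually_const_lt (by simpa using h)).filter_mono
    (nhdsWithin_le_nhds (s := Iio 1))
  have hIoo : Ioo (-1 : ℝ) 1 ∈ 𝓝[<] (1 : ℝ) := Ioo_mem_nhdsLT (by norm_num)
  obtain ⟨x, hx1, hx2⟩ := (hev.and hIoo).exists
  exact ⟨x, hx2.1, hx2.2, hx1⟩

theorem exists_mul_log_lt {a c α : ℝ} (hc : |c| < 1) (h : a * Real.log (1 - c) < -α) :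
    ∃ x : ℝ, -1 < x ∧ x < 1 ∧ a * Real.log (1 + c * x) < -α := by
  obtain ⟨x, h1, h2, h3⟩ := exists_lt_mul_log (a := -a) (c := -c) (γ := α) (by rwa [abs_neg])
    (by rw [← sub_eq_add_neg]; linarith)
  refine ⟨-x, by linarith, by linarith, ?_⟩
  rw [mul_neg, ← neg_mul]
  linarith

theorem hasDerivAt_mul_log_one_add_mul {a c : ℝ} (hc : |c| < 1) {z : ℂ} (hz : z ∈ ball (0 : ℂ) 1) :
    HasDerivAt (fun z : ℂ => a * log (1 + c * z)) (a * (c / (1 + c * z))) z := by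
  have h1 : HasDerivAt (fun z : ℂ => 1 + c * z) c z := by
    simpa using ((hasDerivAt_id z).const_mul (c : ℂ)).const_add 1
  refine (h1.clog (mem_slitPlane_of_norm_lt_one ?_)).const_mul _
  rw [mem_ball_zero_iff] at hz
  rw [norm_mul, norm_real, Real.norm_eq_abs]
  nlinarith [norm_nonneg z, abs_nonneg c]

theorem ofReal_mul_log_one_add_mul {a c x : ℝ} (hc : |c| < 1) (h1 : -1 < x) (h2 : x < 1) :
    (a : ℂ) * log (1 + c * x) = ((a * Real.log (1 + c * x) : ℝ) : ℂ) := by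
  have hpos : 0 ≤ 1 + c * x := by nlinarith [abs_lt.mp hc]
  push_cast [ofReal_log hpos]
  rfl

/-- A solution of the differential equation for the Schwarz function `z ↦ (c / B) * z`. -/
theorem subordinate_diffExpr_of_mul_deriv_eq {A B β c : ℝ} (hB : |B| < 1) (hB0 : B ≠ 0)
    (hβ : β ≠ 0) (hc : |c| ≤ |B|) {j : ℕ} {p : ℂ → ℂ}
    (hp : ∀ z ∈ ball (0 : ℂ) 1, deriv p z / p z ^ j
      = ((A - B) / (β * B) : ℝ) * (c / (1 + c * z))) :
    Subordinate (diffExpr β j p) (janowski A B) := by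
  have hBC : (B : ℂ) ≠ 0 := ofReal_ne_zero.mpr hB0
  rw [subordinate_diffExpr_iff hB hB0 hβ]
  refine ⟨fun z => (c / B : ℝ) * z, by fun_prop, by simp, fun z hz => ?_, fun z hz => ?_⟩
  · rw [mem_ball_zero_iff] at hz
    rw [norm_mul, norm_real, Real.norm_eq_abs, abs_div]
    have : |c| / |B| ≤ 1 := div_le_one_of_le₀ hc (abs_nonneg B)
    nlinarith [norm_nonneg z]
  · have e : (B : ℂ) * ((c / B : ℝ) * z) = c * z := by push_cast; field_simp
    beta_reduce
    rw [e, mul_div_assoc, hp z hz]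
    ring

theorem endpointNecessary_zero {A B : ℝ} (hB : |B| < 1) (hB0 : B ≠ 0) :
    EndpointNecessary A B 0 (2 / 3) (2 / 3) := by
  intro β hβ hend
  set a := (A - B) / (β * B) with ha
  have hd : ∀ z ∈ ball (0 : ℂ) 1, HasDerivAt (fun z : ℂ => 1 + a * log (1 + B * z))
      (a * (B / (1 + B * z))) z := fun z hz =>
    (hasDerivAt_mul_log_one_add_mul hB hz).const_add 1
  refine ⟨fun z => 1 + a * log (1 + B * z), ⟨fun z hz =>
    (hd z hz).differentiableAt.differentiableWithinAt, by simp⟩, fun h => absurd rfl h,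
    subordinate_diffExpr_of_mul_deriv_eq hB hB0 hβ.ne' le_rfl fun z hz => by
      rw [(hd z hz).deriv, pow_zero, div_one], fun hsub => ?_⟩
  have hval : ∀ x : ℝ, -1 < x → x < 1 →
      1 / 3 < 1 + a * Real.log (1 + B * x) ∧ 1 + a * Real.log (1 + B * x) < 5 / 3 :=
    fun x h1 h2 => hsub.real_value_bounds (ofReal_mem_unitBall h1 h2)
      (by rw [ofReal_mul_log_one_add_mul hB h1 h2]; push_cast; rfl)
  rcases hend with h | h
  · obtain ⟨x, h1, h2, h3⟩ := exists_mul_log_lt hB h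
    linarith [(hval x h1 h2).1]
  · obtain ⟨x, h1, h2, h3⟩ := exists_lt_mul_log hB h
    linarith [(hval x h1 h2).2]

theorem endpointNecessary_one {A B : ℝ} (hB : |B| < 1) (hB0 : B ≠ 0) :
    EndpointNecessary A B 1 (Real.log 3) (Real.log (5 / 3)) := by
  intro β hβ hend
  set a := (A - B) / (β * B) with ha
  have hd : ∀ z ∈ ball (0 : ℂ) 1, HasDerivAt (fun z : ℂ => exp (a * log (1 + B * z)))
      (exp (a * log (1 + B * z)) * (a * (B / (1 + B * z)))) z := fun z hz =>
    (hasDerivAt_mul_log_one_add_mul hB hz).cexp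
  refine ⟨fun z => exp (a * log (1 + B * z)), ⟨fun z hz =>
    (hd z hz).differentiableAt.differentiableWithinAt, by simp⟩, fun _ z _ => exp_ne_zero _,
    subordinate_diffExpr_of_mul_deriv_eq hB hB0 hβ.ne' le_rfl fun z hz => by
      rw [(hd z hz).deriv, pow_one, mul_div_cancel_left₀ _ (exp_ne_zero _)], fun hsub => ?_⟩
  have hval : ∀ x : ℝ, -1 < x → x < 1 → 1 / 3 < Real.exp (a * Real.log (1 + B * x)) ∧
      Real.exp (a * Real.log (1 + B * x)) < 5 / 3 :=
    fun x h1 h2 => hsub.real_value_bounds (ofReal_mem_unitBall h1 h2)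
      (by rw [ofReal_mul_log_one_add_mul hB h1 h2, ofReal_exp])
  rcases hend with h | h
  · obtain ⟨x, h1, h2, h3⟩ := exists_mul_log_lt hB h
    have h4 := Real.exp_lt_exp.mpr h3
    rw [Real.exp_neg, Real.exp_log (by norm_num)] at h4
    linarith [(hval x h1 h2).1]
  · obtain ⟨x, h1, h2, h3⟩ := exists_lt_mul_log hB h
    have h4 := Real.exp_lt_exp.mpr h3
    rw [Real.exp_log (by norm_num)] at h4
    linarith [(hval x h1 h2).2]

/-- The function `1 / (1 - a * log (1 + c * z))` shows that the implication fails for `j = 2`, as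
long as its denominator has no zeros in the disk, which is the role of `a * log (1 + c) < 1`. -/
theorem exists_not_subordinate_nephroid_two {A B β c : ℝ} (hB : |B| < 1) (hB0 : B ≠ 0)
    (hβ : β ≠ 0) (hc : |c| ≤ |B|) (hac : 0 < (A - B) / (β * B) * c)
    (hlt : (A - B) / (β * B) * Real.log (1 + c) < 1)
    (hend : (A - B) / (β * B) * Real.log (1 - c) < -2 ∨
      2 / 5 < (A - B) / (β * B) * Real.log (1 + c)) :
    ∃ p : ℂ → ℂ, IsNormalized p ∧ (∀ z ∈ ball (0 : ℂ) 1, p z ≠ 0) ∧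
      Subordinate (diffExpr β 2 p) (janowski A B) ∧ ¬ Subordinate p nephroid := by
  set a := (A - B) / (β * B) with ha
  have hc1 : |c| < 1 := hc.trans_lt hB
  have hre : ∀ z ∈ ball (0 : ℂ) 1, 0 < (1 - a * log (1 + c * z)).re := by
    intro z hz
    rw [mem_ball_zero_iff] at hz
    have h1 := norm_mul_log_one_add_sub_le hac hc1 (α := -(a * Real.log (1 - c)))
      (γ := a * Real.log (1 + c)) (by simp) le_rfl (x := c * z) (by
        rw [norm_mul, norm_real, Real.norm_eq_abs]
        exact mul_le_of_le_one_right (abs_nonneg c) hz.le)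
    have h2 := (re_le_norm _).trans h1
    rw [sub_re, ofReal_re] at h2
    rw [sub_re, one_re]
    linarith
  have hne : ∀ z ∈ ball (0 : ℂ) 1, 1 - a * log (1 + c * z) ≠ 0 := fun z hz h => by
    simpa [h] using hre z hz
  have hd : ∀ z ∈ ball (0 : ℂ) 1, HasDerivAt (fun z : ℂ => (1 - a * log (1 + c * z))⁻¹)
      (-(-(a * (c / (1 + c * z)))) / (1 - a * log (1 + c * z)) ^ 2) z := fun z hz =>
    ((hasDerivAt_mul_log_one_add_mul hc1 hz).const_sub 1).fun_inv (hne z hz)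
  refine ⟨fun z => (1 - a * log (1 + c * z))⁻¹, ⟨fun z hz =>
    (hd z hz).differentiableAt.differentiableWithinAt, by simp⟩,
    fun z hz => inv_ne_zero (hne z hz),
    subordinate_diffExpr_of_mul_deriv_eq hB hB0 hβ hc fun z hz => ?_, fun hsub => ?_⟩
  · have := hne z hz
    rw [(hd z hz).deriv, neg_neg, inv_pow, div_inv_eq_mul, div_mul_cancel₀ _ (pow_ne_zero 2 this)]
  have hval : ∀ x : ℝ, -1 < x → x < 1 → 0 < 1 - a * Real.log (1 + c * x) ∧
      1 / 3 < (1 - a * Real.log (1 + c * x))⁻¹ ∧ (1 - a * Real.log (1 + c * x))⁻¹ < 5 / 3 := by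
    intro x h1 h2
    have hx := ofReal_mem_unitBall h1 h2
    refine ⟨?_, hsub.real_value_bounds hx ?_⟩
    · have := hre x hx
      rwa [ofReal_mul_log_one_add_mul hc1 h1 h2, sub_re, one_re, ofReal_re] at this
    · rw [ofReal_mul_log_one_add_mul hc1 h1 h2]
      push_cast
      rfl
  rcases hend with h | h
  · obtain ⟨x, h1, h2, h3⟩ := exists_mul_log_lt hc1 h
    obtain ⟨h4, h5, -⟩ := hval x h1 h2
    rw [lt_inv_comm₀ (by norm_num) h4] at h5
    norm_num at h5
    linarith
  · obtain ⟨x, h1, h2, h3⟩ := exists_lt_mul_log hc1 h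
    obtain ⟨h4, -, h5⟩ := hval x h1 h2
    rw [inv_lt_comm₀ h4 (by norm_num)] at h5
    norm_num at h5
    linarith

theorem endpointNecessary_two {A B : ℝ} (hB : |B| < 1) (hB0 : B ≠ 0) (hBA : B < A) :
    EndpointNecessary A B 2 2 (2 / 5) := by
  intro β hβ hend
  have haB := div_mul_mul_self_pos hB0 hBA hβ
  rcases le_or_gt ((A - B) / (β * B) * Real.log (1 + B)) (2 / 5) with h | h
  · obtain ⟨p, h1, h2, h3⟩ := exists_not_subordinate_nephroid_two hB hB0 hβ.ne' le_rfl haB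
      (by linarith) hend
    exact ⟨p, h1, fun _ => h2, h3⟩
  · -- For small `β` the solution with `c = B` may have a pole in the disk. Hence `c` is taken
    -- between `0` and `B` with `a * log (1 + c)` in the interval `(2 / 5, 1)`.
    set a := (A - B) / (β * B) with ha
    set τ := min (1 / 2) (a * Real.log (1 + B)) with hτ
    have hτ1 : 2 / 5 < τ := lt_min (by norm_num) h
    have hτ2 : τ ≤ 1 / 2 := min_le_left _ _
    have hτ3 : τ ≤ a * Real.log (1 + B) := min_le_right _ _
    have hB1 : 0 < 1 + B := by linarith [(abs_lt.mp hB).1]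
    have ha0 : a ≠ 0 := left_ne_zero_of_mul haB.ne'
    set c := Real.exp (τ / a) - 1 with hc
    have hlog : a * Real.log (1 + c) = τ := by
      rw [hc, add_sub_cancel, Real.log_exp]
      field_simp
    have hcB : |c| ≤ |B| ∧ 0 < a * c := by
      rcases pos_and_pos_or_neg_and_neg_of_mul_pos haB with ⟨h3, h4⟩ | ⟨h3, h4⟩
      · have h5 : 0 < c := by
          rw [hc, sub_pos]
          exact Real.one_lt_exp_iff.mpr (div_pos (by linarith) h3)
        have h6 : Real.exp (τ / a) ≤ 1 + B := by
          rw [← Real.le_log_iff_exp_le hB1, div_le_iff₀ h3]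
          linarith
        rw [abs_of_pos h5, abs_of_pos h4]
        exact ⟨by linarith, mul_pos h3 h5⟩
      · have h5 : c < 0 := by
          rw [hc, sub_neg]
          exact Real.exp_lt_one_iff.mpr (div_neg_of_pos_of_neg (by linarith) h3)
        have h6 : 1 + B ≤ Real.exp (τ / a) := by
          rw [← Real.log_le_iff_le_exp hB1, le_div_iff_of_neg h3]
          linarith
        rw [abs_of_neg h5, abs_of_neg h4]
        exact ⟨by linarith, mul_pos_of_neg_of_neg h3 h5⟩
    obtain ⟨p, h1, h2, h3⟩ := exists_not_subordinate_nephroid_two (A := A) hB hB0 hβ.ne' hcB.1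
      hcB.2 (by rw [← ha, hlog]; linarith) (Or.inr (by rw [← ha, hlog]; exact hτ1))
    exact ⟨p, h1, fun _ => h2, h3⟩

/-! ### The best possible bounds -/

/-- The two endpoint conditions on `a = (A - B) / (β * B)`, rewritten as lower bounds for `β`. -/
theorem bestPossibleBound_of_endpoint {A B α γ : ℝ} {j : ℕ} (hB : |B| < 1) (hB0 : B ≠ 0)
    (hBA : B < A) (hα : 0 < α) (hγ : 0 < γ) (hs : EndpointSufficient A B j α γ)
    (hn : EndpointNecessary A B j α γ) :
    BestPossibleBound A B j (max ((A - B) / B * -Real.log (1 - B) / α)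
      ((A - B) / B * Real.log (1 + B) / γ)) := by
  set M := max ((A - B) / B * -Real.log (1 - B) / α) ((A - B) / B * Real.log (1 + B) / γ) with hM
  have hMpos : 0 < M := by
    refine lt_max_of_lt_right (div_pos ?_ hγ)
    have h1 : 0 < A - B := sub_pos.mpr hBA
    rcases lt_or_gt_of_ne hB0 with h | h
    · exact mul_pos_of_neg_of_neg (div_neg_of_pos_of_neg h1 h)
        (Real.log_neg (by linarith [(abs_lt.mp hB).1]) (by linarith))
    · exact mul_pos (div_pos h1 h) (Real.log_pos (by linarith))
  have hscale : ∀ β x : ℝ, (A - B) / (β * B) * x = (A - B) / B * x / β := fun β x => by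
    rw [mul_comm β, ← div_div]; ring
  have hfails : FailsBelow A B j M := by
    intro β hβ hβM
    refine hn β hβ ?_
    rw [hscale, hscale]
    rcases lt_max_iff.mp hβM with h | h
    · left
      rw [lt_div_iff₀ hα] at h
      rw [div_lt_iff₀ hβ]
      linarith
    · right
      rw [lt_div_iff₀ hγ] at h
      rw [lt_div_iff₀ hβ]
      linarith
  refine ⟨⟨fun β hMβ => ?_, fun b hb => ?_⟩, hfails⟩
  · have hβ : 0 < β := hMpos.trans_le hMβ
    obtain ⟨h1, h2⟩ := max_le_iff.mp hMβ
    refine hs β hβ ?_ ?_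
    · rw [hscale, le_div_iff₀ hβ]
      rw [div_le_iff₀ hα] at h1
      linarith
    · rw [hscale, div_le_iff₀ hβ]
      rw [div_le_iff₀ hγ] at h2
      linarith
  · by_contra! hbM
    obtain ⟨p, h1, -, h2, h3⟩ := hfails (max b (M / 2)) (lt_max_of_lt_right (by linarith))
      (max_lt hbM (by linarith))
    exact h3 (hb _ (le_max_left _ _) p h1 h2)

theorem mainTheorem9 (A B : ℝ) (hB : -1 < B) (hBA : B < A) (hA : A ≤ 1) (hB0 : B ≠ 0) :
    BestPossibleBound A B 0
      (max ((A - B) / (2 * B) * Real.log ((1 - B) ^ (-3 : ℤ)))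
        ((A - B) / (2 * B) * Real.log ((1 + B) ^ 3))) ∧
    BestPossibleBound A B 1
      (max ((A - B) / (B * Real.log 3) * Real.log ((1 - B) ^ (-1 : ℤ)))
        ((A - B) / (B * Real.log (5 / 3)) * Real.log (1 + B))) ∧
    BestPossibleBound A B 2
      (max ((A - B) / (2 * B) * Real.log ((1 - B) ^ (-1 : ℤ)))
        ((A - B) / (2 * B) * Real.log ((1 + B) ^ 5))) := by
  have hB1 : |B| < 1 := abs_lt.mpr ⟨hB, hBA.trans_le hA⟩
  have h3 : (0 : ℝ) < Real.log 3 := Real.log_pos (by norm_num)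
  have h53 : (0 : ℝ) < Real.log (5 / 3) := Real.log_pos (by norm_num)
  refine ⟨?_, ?_, ?_⟩
  · convert bestPossibleBound_of_endpoint hB1 hB0 hBA (by norm_num) (by norm_num)
      (endpointSufficient_zero hB1 hB0 hBA) (endpointNecessary_zero hB1 hB0) using 2
    · rw [Real.log_zpow]; push_cast; field_simp
    · rw [Real.log_pow]; push_cast; field_simp
  · convert bestPossibleBound_of_endpoint hB1 hB0 hBA h3 h53
      (endpointSufficient_one hB1 hB0 hBA) (endpointNecessary_one hB1 hB0) using 2
    · rw [Real.log_zpow]; push_cast; field_simp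
    · field_simp
  · convert bestPossibleBound_of_endpoint hB1 hB0 hBA (by norm_num) (by norm_num)
      (endpointSufficient_two hB1 hB0 hBA) (endpointNecessary_two hB1 hB0 hBA) using 2
    · rw [Real.log_zpow]; push_cast; field_simp
    · rw [Real.log_pow]; push_cast; field_simp
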